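/- Conventions. A proximate order with limit $\rho$ is a real function $\rho(r)$ defined on some interval $(c,\infty)$, $c\ge 0$, such that: (A) it is continuous and piecewise continuously differentiable, i.e. continuously differentiable outside a (possibly empty or finite) set of points without finite accumulation point, and at each point of this set it has distinct finite one-sided derivatives; (B) $\rho(r)\ge 0$; (C) $\lim_{r\to\infty}\rho(r)=\rho<\infty$; (D) $\lim_{r\to\infty} r\rho'(r)\log r=0$ (along the points where $\rho'$ exists). It is nonzero if $\rho>0$. Two proximate orders are equivalent if the product of their difference with $\log r$ tends to $0$ as $r\to\infty$. For functions given by a formula, such as $\rho_V$ and $d_{\mathbb L}$ below, being a proximate order means being so on $(c,\infty)$ for some $c$. For $\gamma>0$ let $L(\gamma)=\{(r,\theta): r>0,\ |\theta|<\gamma\}$, a sector of the Riemann surface of the logarithm. For a proximate order $\rho(r)\to\rho>0$ and $\gamma>0$, $\mathfrak B(\gamma,\rho(r))$ is the class of holomorphic functions $V$ on $L(\gamma)$ such that: (I) $V(zr)/V(r)\to z^{\rho}$ as $r\to\infty$, uniformly on compact subsets of $L(\gamma)$; (II) $\overline{V(z)}=V(\overline z)$; (III) $V$ is real, positive and strictly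 increasing on $(0,\infty)$ and $V(r)\to0$ as $r\to0^+$; (IV) $t\mapsto V(e^t)$ is strictly convex on $\mathbb R$; (V) $\log V(r)$ is strictly concave on $(0,\infty)$; (VI) $\rho_V(r)=\log V(r)/\log r$ is a proximate order equivalent to $\rho(r)$. Put $M^V_p=\sup_{t>0}t^p e^{-V(t)}$, $p\in\mathbb N_0$. Proposition. Let $\rho(r)\to\rho>0$ be a proximate order, $\gamma>0$ and $V\in\mathfrak B(\gamma,\rho(r))$. Then $V$ maps $(0,\infty)$ bijectively onto $(0,\infty)$; let $U:(0,\infty)\to(0,\infty)$ be the inverse of this bijection, and let $\mathbb L=(L_p)_{p\in\mathbb N_0}$ be the sequence of positive numbers with $L_0=1$ and quotients $\ell_p=L_{p+1}/L_p$ given by $\ell_0=U(1)$ and $\ell_p=U(p)$ for $p\ge1$. Then: 1. $\mathbb L$ is logarithmically convex, $L_p^2\le L_{p-1}L_{p+1}$ for $p\ge1$, and $\ell_p\to\infty$; 2. $\mathbb L$ is equivalent to $(M^V_p)_p$: there are $C,D>0$ with $D^pM^V_p\le L_p\le C^pM^V_p$ for all $p\in\mathbb N_0$; 3. $d_{\mathbb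 L}(t)=\log(L(t))/\log t$ ($t$ large), where $L(t)=\sup_{p\in\mathbb N_0}\log(t^p/L_p)$, is a nonzero proximate order. In particular there is a logarithmically convex sequence $\mathbb L$, with quotients tending to infinity, that is equivalent to $(M^V_p)_p$ and for which $d_{\mathbb L}$ is a nonzero proximate order. -/

import Mathlib

open Set Filter Topology

/-- `ρ` is a proximate order with limit `l` at infinity. A proximate order is a real function on some
half-line `(c, ∞)`; it is represented by a total function whose values outside `(c, ∞)` are ignored. -/
def IsProximateOrder (ρ : ℝ → ℝ) (l : ℝ) : Prop :=
  ∃ c : ℝ, 0 ≤ c ∧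
    -- continuous and piecewise continuously differentiable: the points where `ρ` is not
    -- differentiable are finitely many or form a sequence tending to infinity, the derivative is
    -- continuous elsewhere, and at these points there are distinct finite lateral derivatives
    ContinuousOn ρ (Ioi c) ∧
    (∀ b : ℝ, {r : ℝ | c < r ∧ r ≤ b ∧ ¬ DifferentiableAt ℝ ρ r}.Finite) ∧
    ContinuousOn (deriv ρ) {r : ℝ | c < r ∧ DifferentiableAt ℝ ρ r} ∧
    (∀ r : ℝ, c < r → ¬ DifferentiableAt ℝ ρ r →
      ∃ a b : ℝ, a ≠ b ∧ HasDerivWithinAt ρ a (Iio r) r ∧ HasDerivWithinAt ρ b (Ioi r) r) ∧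
    -- nonnegative
    (∀ r : ℝ, c < r → 0 ≤ ρ r) ∧
    -- convergent to `l`
    Tendsto ρ atTop (𝓝 l) ∧
    -- `r ρ'(r) log r → 0`, the limit being taken along the points where the derivative exists
    Tendsto (fun r : ℝ => r * deriv ρ r * Real.log r)
      (atTop ⊓ 𝓟 {r : ℝ | DifferentiableAt ℝ ρ r}) (𝓝 0)

/-- A proximate order whose limit at infinity is positive. -/
def IsNonzeroProximateOrder (ρ : ℝ → ℝ) : Prop :=
  ∃ l : ℝ, 0 < l ∧ IsProximateOrder ρ l

/-- Equivalence of (proximate order) functions. -/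
def ProximateEquivalent (ρ₁ ρ₂ : ℝ → ℝ) : Prop :=
  Tendsto (fun r : ℝ => (ρ₁ r - ρ₂ r) * Real.log r) atTop (𝓝 0)

/-- The sector `L(γ) = {(r, θ) : |θ| < γ, r > 0}` of the Riemann surface of the logarithm, whose points
are given by their modulus `r > 0` and their argument `θ ∈ ℝ`. -/
def logSector (γ : ℝ) : Set (ℝ × ℝ) :=
  {z | 0 < z.1 ∧ |z.2| < γ}

/-- Holomorphy on the sector `L(γ)`: `ζ = log z = log r + i θ` is a global holomorphic coordinate of the
Riemann surface of the logarithm, in which `L(γ)` is the strip `|Im ζ| < γ`. -/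
def HolomorphicOnLogSector (γ : ℝ) (V : ℝ × ℝ → ℂ) : Prop :=
  DifferentiableOn ℂ (fun ζ : ℂ => V (Real.exp ζ.re, ζ.im)) {ζ : ℂ | |ζ.im| < γ}

/-- The power `z ^ a = r ^ a * e ^ (i a θ)` of the point `z = (r, θ)`. -/
noncomputable def logPow (z : ℝ × ℝ) (a : ℝ) : ℂ :=
  ((z.1 ^ a : ℝ) : ℂ) * Complex.exp (((a * z.2 : ℝ) : ℂ) * Complex.I)

/-- The restriction of `V` to the positive real axis (where functions of the class below are real). -/
noncomputable def onRay (V : ℝ × ℝ → ℂ) (r : ℝ) : ℝ :=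
  (V (r, 0)).re

/-- `V` belongs to the class `𝔅(γ, ρ(r))`, where `l` is the limit of `ρ(r)` at infinity. -/
structure MemMaergoizClass (γ : ℝ) (ρ : ℝ → ℝ) (l : ℝ) (V : ℝ × ℝ → ℂ) : Prop where
  holomorphic : HolomorphicOnLogSector γ V
  /-- `V(z r) / V(r) → z ^ l` as `r → ∞`, uniformly on the compact subsets of `L(γ)`. -/
  regular_variation : ∀ K : Set (ℝ × ℝ), K ⊆ logSector γ → IsCompact K →
    TendstoUniformlyOn (fun (r : ℝ) (z : ℝ × ℝ) => V (z.1 * r, z.2) / V (r, 0))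
      (fun z => logPow z l) atTop K
  /-- Symmetry under complex conjugation. -/
  conj_symm : ∀ z ∈ logSector γ, (starRingEnd ℂ) (V z) = V (z.1, -z.2)
  /-- `V` is real, positive and strictly increasing on `(0, ∞)`, with limit `0` at `0`. -/
  real_on_ray : ∀ r : ℝ, 0 < r → (V (r, 0)).im = 0
  pos : ∀ r : ℝ, 0 < r → 0 < onRay V r
  strictMono : StrictMonoOn (onRay V) (Ioi 0)
  tendsto_zero : Tendsto (onRay V) (𝓝[>] 0) (𝓝 0)
  /-- `V` is strictly convex relative to `log r`. -/
  strictConvex_exp : StrictConvexOn ℝ univ (fun t : ℝ => onRay V (Real.exp t))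
  /-- `log V(r)` is strictly concave. -/
  strictConcave_log : StrictConcaveOn ℝ (Ioi 0) (fun r : ℝ => Real.log (onRay V r))
  /-- `ρ_V(r) = log V(r) / log r` is a proximate order, equivalent to `ρ`. -/
  proximate : ∃ l' : ℝ, IsProximateOrder (fun r : ℝ => Real.log (onRay V r) / Real.log r) l'
  equivalent : ProximateEquivalent (fun r : ℝ => Real.log (onRay V r) / Real.log r) ρ

/-- The sequence `M^V_p = sup_{t > 0} t ^ p / e ^ V(t)`. -/
noncomputable def maergoizSequence (V : ℝ × ℝ → ℂ) (p : ℕ) : ℝ :=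
  ⨆ t : Ioi (0 : ℝ), (t : ℝ) ^ p / Real.exp (onRay V t)

/-- Sequences of positive real numbers with `M_0 = 1`. -/
def IsNormalizedPosSeq (M : ℕ → ℝ) : Prop :=
  M 0 = 1 ∧ ∀ p, 0 < M p

/-- Logarithmic convexity: `M_p ^ 2 ≤ M_{p-1} M_{p+1}` for `p ≥ 1`. -/
def IsLogConvexSeq (M : ℕ → ℝ) : Prop :=
  ∀ p : ℕ, M (p + 1) ^ 2 ≤ M p * M (p + 2)

/-- The sequence of quotients `m_p = M_{p+1} / M_p`. -/
noncomputable def seqQuotient (M : ℕ → ℝ) (p : ℕ) : ℝ :=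
  M (p + 1) / M p

/-- Equivalence of sequences, `M ≈ L`. -/
def SeqEquivalent (M L : ℕ → ℝ) : Prop :=
  ∃ C D : ℝ, 0 < C ∧ 0 < D ∧ ∀ p : ℕ, D ^ p * L p ≤ M p ∧ M p ≤ C ^ p * L p

/-- The associated function `M(t) = sup_p log (t ^ p / M_p)`, for `t > 0`. -/
noncomputable def associatedFunction (M : ℕ → ℝ) (t : ℝ) : ℝ :=
  ⨆ p : ℕ, Real.log (t ^ p / M p)

/-- `d_M(t) = log M(t) / log t`, for `t` large. -/
noncomputable def dFunction (M : ℕ → ℝ) (t : ℝ) : ℝ :=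
  Real.log (associatedFunction M t) / Real.log t

/-- `U` is the inverse of the bijection `f : (0, ∞) → (0, ∞)`. -/
def IsInverseOnPos (U f : ℝ → ℝ) : Prop :=
  MapsTo f (Ioi 0) (Ioi 0) ∧ MapsTo U (Ioi 0) (Ioi 0) ∧ InvOn U f (Ioi 0) (Ioi 0)

/-! Write f for V on the ray. Expanding `t * ρ_V'(t) * log t` shows that it equals t f'(t)/f(t) −
ρ_V(t), so condition (D) gives t f'/f → l, while convexity of f ∘ exp and monotonicity give f' > 0
(`MemMaergoizClass.exists_regularGrowth`). The rest uses only these growth facts, collected in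
`RegularGrowth`. Equivalence: t f'/f ≥ c > 0 away from 0 gives log U(p) − log U(i) ≤ (log p − log
i)/c. Summing over i and using a Stirling bound puts log L_p within O(p) of p log U(p); the supremum
of p log t − f(t) lies within O(p) of the same quantity. Proximate order: for f(t) ≥ 1 exactly
⌊f(t)⌋ + 1 quotients are at most t, so the associated function a has right derivative (⌊f⌋ + 1)/t.
L'Hôpital's rule gives a/f → 1/l. Hence d = log a / log t → l, and where d is differentiable, t d'
log t = (⌊f⌋ + 1)/a − d → l − l = 0. Corners of d occur only where f takes integer values. -/

/-- L'Hôpital's rule at infinity for right derivatives, in the `∞ / ∞` form. -/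
theorem tendsto_div_of_right_deriv {a b a' b' : ℝ → ℝ} {t₀ K : ℝ}
    (ha : ContinuousOn a (Ioi t₀)) (hb : ContinuousOn b (Ioi t₀))
    (ha' : ∀ t > t₀, HasDerivWithinAt a (a' t) (Ici t) t)
    (hb' : ∀ t > t₀, HasDerivWithinAt b (b' t) (Ici t) t)
    (hpos : ∀ t > t₀, 0 < b' t) (hK : Tendsto (fun t => a' t / b' t) atTop (𝓝 K))
    (hinf : Tendsto b atTop atTop) : Tendsto (fun t => a t / b t) atTop (𝓝 K) := by
  have upper : ∀ M, K < M → ∃ A, ∀ᶠ t in atTop, a t ≤ A + M * b t := by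
    intro M hM
    obtain ⟨t₁, h₁⟩ := eventually_atTop.1 (hK.eventually (gt_mem_nhds hM))
    set s := max t₁ (t₀ + 1)
    have hs : t₀ < s := lt_of_lt_of_le (lt_add_one _) (le_max_right _ _)
    -- This constant makes both sides agree at s; from there the right derivatives compare.
    refine ⟨a s - M * b s, ?_⟩
    filter_upwards [eventually_ge_atTop s] with t ht
    have hsub : Icc s t ⊆ Ioi t₀ := fun x hx => hs.trans_le hx.1
    refine image_le_of_deriv_right_le_deriv_boundary (a := s) (b := t) (f := a) (f' := a')
      (B := fun x => a s - M * b s + M * b x) (B' := fun x => M * b' x)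
      (ha.mono hsub) (fun x hx => ha' x (hs.trans_le hx.1)) (by simp)
      (continuousOn_const.add (continuousOn_const.mul (hb.mono hsub)))
      (fun x hx => ((hb' x (hs.trans_le hx.1)).const_mul M).const_add _) (fun x hx => ?_)
      (right_mem_Icc.2 ht)
    have := h₁ x ((le_max_left _ _).trans hx.1)
    exact ((div_lt_iff₀ (hpos x (hs.trans_le hx.1))).1 this).le
  have lower : ∀ M, M < K → ∃ A, ∀ᶠ t in atTop, A + M * b t ≤ a t := by
    intro M hM
    obtain ⟨t₁, h₁⟩ := eventually_atTop.1 (hK.eventually (lt_mem_nhds hM))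
    set s := max t₁ (t₀ + 1)
    have hs : t₀ < s := lt_of_lt_of_le (lt_add_one _) (le_max_right _ _)
    refine ⟨a s - M * b s, ?_⟩
    filter_upwards [eventually_ge_atTop s] with t ht
    have hsub : Icc s t ⊆ Ioi t₀ := fun x hx => hs.trans_le hx.1
    refine image_le_of_deriv_right_le_deriv_boundary (a := s) (b := t) (B := a) (B' := a')
      (f := fun x => a s - M * b s + M * b x) (f' := fun x => M * b' x)
      (continuousOn_const.add (continuousOn_const.mul (hb.mono hsub)))
      (fun x hx => ((hb' x (hs.trans_le hx.1)).const_mul M).const_add _) (by simp)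
      (ha.mono hsub) (fun x hx => ha' x (hs.trans_le hx.1)) (fun x hx => ?_)
      (right_mem_Icc.2 ht)
    have := h₁ x ((le_max_left _ _).trans hx.1)
    exact ((lt_div_iff₀ (hpos x (hs.trans_le hx.1))).1 this).le
  have aux : ∀ A M : ℝ, Tendsto (fun t => A / b t + M) atTop (𝓝 M) := fun A M => by
    simpa using (hinf.const_div_atTop A).add_const M
  refine tendsto_order.2 ⟨fun y hy => ?_, fun y hy => ?_⟩
  · obtain ⟨M, hM₁, hM₂⟩ := exists_between hy
    obtain ⟨A, hA⟩ := lower M hM₂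
    filter_upwards [hA, hinf.eventually_gt_atTop 0, (aux A M).eventually (lt_mem_nhds hM₁)]
      with t h1 h2 h3
    refine h3.trans_le ?_
    rw [le_div_iff₀ h2, add_mul, div_mul_cancel₀ _ h2.ne']
    exact h1
  · obtain ⟨M, hM₁, hM₂⟩ := exists_between hy
    obtain ⟨A, hA⟩ := upper M hM₁
    filter_upwards [hA, hinf.eventually_gt_atTop 0, (aux A M).eventually (gt_mem_nhds hM₂)]
      with t h1 h2 h3
    refine lt_of_le_of_lt ?_ h3
    rw [div_le_iff₀ h2, add_mul, div_mul_cancel₀ _ h2.ne']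
    exact h1

/-! ### Regular growth: bijectivity and a lower power bound -/

/-- Increasing `C¹` functions on `(0, ∞)` from `0` to `∞` with positive derivative that vary
regularly with index `l` in the strong sense `t f'(t) / f(t) → l`. -/
structure RegularGrowth (f f' : ℝ → ℝ) (l : ℝ) : Prop where
  index_pos : 0 < l
  pos : ∀ t, 0 < t → 0 < f t
  strictMono : StrictMonoOn f (Ioi 0)
  hasDerivAt : ∀ t, 0 < t → HasDerivAt f (f' t) t
  continuousOn_deriv : ContinuousOn f' (Ioi 0)
  deriv_pos : ∀ t, 0 < t → 0 < f' t
  tendsto_zero : Tendsto f (𝓝[>] 0) (𝓝 0)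
  tendsto_log : Tendsto (fun t => Real.log (f t) / Real.log t) atTop (𝓝 l)
  tendsto_index : Tendsto (fun t => t * f' t / f t) atTop (𝓝 l)

namespace RegularGrowth

variable {f f' : ℝ → ℝ} {l : ℝ}

theorem continuousOn (h : RegularGrowth f f' l) : ContinuousOn f (Ioi 0) :=
  fun t ht => (h.hasDerivAt t ht).continuousAt.continuousWithinAt

theorem tendsto_atTop (h : RegularGrowth f f' l) : Tendsto f atTop atTop := by
  have h1 : Tendsto (fun t => Real.log (f t)) atTop atTop := by
    refine (h.tendsto_log.pos_mul_atTop h.index_pos Real.tendsto_log_atTop).congr' ?_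
    filter_upwards [eventually_gt_atTop 1] with t ht
    exact div_mul_cancel₀ _ (Real.log_pos ht).ne'
  refine (Real.tendsto_exp_atTop.comp h1).congr' ?_
  filter_upwards [eventually_gt_atTop 0] with t ht
  exact Real.exp_log (h.pos t ht)

theorem bijOn (h : RegularGrowth f f' l) : BijOn f (Ioi 0) (Ioi 0) := by
  refine ⟨fun t ht => h.pos t ht, h.strictMono.injOn, fun y hy => ?_⟩
  have hy' : (0 : ℝ) < y := hy
  obtain ⟨a, hay, ha⟩ :=
    ((h.tendsto_zero.eventually (gt_mem_nhds hy')).and self_mem_nhdsWithin).exists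
  obtain ⟨b, hby, hab⟩ := ((h.tendsto_atTop.eventually_gt_atTop y).and
    (eventually_ge_atTop a)).exists
  have ha' : (0 : ℝ) < a := ha
  obtain ⟨t, ht, rfl⟩ := intermediate_value_Icc hab
    (h.continuousOn.mono fun x hx => ha'.trans_le hx.1) ⟨hay.le, hby.le⟩
  exact ⟨t, ha'.trans_le ht.1, rfl⟩

/-- Beyond some b the index exceeds l/2, and before it a positive continuous function on a compact
interval has a positive minimum. Starting at x₀ > 0 matters: the index is not controlled near 0. -/
theorem exists_index_lower_bound (h : RegularGrowth f f' l) {x₀ : ℝ} (hx₀ : 0 < x₀) :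
    ∃ c, 0 < c ∧ ∀ t, x₀ ≤ t → c ≤ t * f' t / f t := by
  obtain ⟨b, hb⟩ := eventually_atTop.1
    (h.tendsto_index.eventually (lt_mem_nhds (half_lt_self h.index_pos)))
  have hsub : Icc x₀ (max b x₀) ⊆ Ioi 0 := fun x hx => hx₀.trans_le hx.1
  have hc : ContinuousOn (fun t => t * f' t / f t) (Icc x₀ (max b x₀)) :=
    ((continuousOn_id.mul h.continuousOn_deriv).div h.continuousOn
      fun t ht => (h.pos t ht).ne').mono hsub
  obtain ⟨m, hm, hmin⟩ := isCompact_Icc.exists_isMinOn ⟨x₀, le_rfl, le_max_right _ _⟩ hc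
  have hm0 : 0 < m := hsub hm
  refine ⟨min (l / 2) (m * f' m / f m), lt_min (half_pos h.index_pos)
    (div_pos (mul_pos hm0 (h.deriv_pos m hm0)) (h.pos m hm0)), fun t ht => ?_⟩
  rcases le_total t (max b x₀) with h' | h'
  · exact (min_le_right _ _).trans (hmin ⟨ht, h'⟩)
  · exact (min_le_left _ _).trans (hb t ((le_max_left _ _).trans h')).le

/-- The index bound says exactly that log f − c log has nonnegative derivative. -/
theorem mul_log_sub_log_le (h : RegularGrowth f f' l) {x₀ c : ℝ} (hx₀ : 0 < x₀)
    (hc : ∀ t, x₀ ≤ t → c ≤ t * f' t / f t) {x y : ℝ} (hx : x₀ ≤ x) (hxy : x ≤ y) :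
    c * (Real.log y - Real.log x) ≤ Real.log (f y) - Real.log (f x) := by
  have hd : ∀ t, 0 < t → HasDerivAt (fun t => Real.log (f t) - c * Real.log t)
      (f' t / f t - c * t⁻¹) t := fun t ht =>
    ((h.hasDerivAt t ht).log (h.pos t ht).ne').sub ((Real.hasDerivAt_log ht.ne').const_mul c)
  have hm : MonotoneOn (fun t => Real.log (f t) - c * Real.log t) (Ici x₀) := by
    refine monotoneOn_of_hasDerivWithinAt_nonneg (convex_Ici x₀)
      (fun t ht => (hd t (hx₀.trans_le ht)).continuousAt.continuousWithinAt)
      (fun t ht => (hd t (hx₀.trans_le (interior_subset ht))).hasDerivWithinAt) fun t ht => ?_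
    have ht' : x₀ ≤ t := interior_subset ht
    have ht0 := hx₀.trans_le ht'
    have := hc t ht'
    rw [sub_nonneg, ← div_eq_mul_inv, div_le_iff₀ ht0]
    calc c ≤ _ := this
      _ = _ := by ring
  have := hm (mem_Ici.2 hx) (mem_Ici.2 (hx.trans hxy)) hxy
  simp only at this
  linarith

end RegularGrowth

/-! ### The sequence whose quotients are the values of the inverse -/

/-- The sequence with `L 0 = 1` and quotients `U 1, U 1, U 2, U 3, …`. -/
noncomputable def inverseProd (U : ℝ → ℝ) (p : ℕ) : ℝ :=
  ∏ i ∈ Finset.range p, U ((max i 1 : ℕ) : ℝ)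

namespace RegularGrowth

variable {f f' U : ℝ → ℝ} {l : ℝ}

theorem exists_inverse (h : RegularGrowth f f' l) : ∃ U, IsInverseOnPos U f :=
  ⟨Function.invFunOn f (Ioi 0), h.bijOn.mapsTo, h.bijOn.surjOn.mapsTo_invFunOn,
    h.bijOn.invOn_invFunOn⟩

theorem inverse_pos (hU : IsInverseOnPos U f) {y : ℝ} (hy : 0 < y) : 0 < U y := hU.2.1 hy

theorem apply_inverse (hU : IsInverseOnPos U f) {y : ℝ} (hy : 0 < y) : f (U y) = y :=
  hU.2.2.2 hy

theorem inverse_le_iff (h : RegularGrowth f f' l) (hU : IsInverseOnPos U f) {y t : ℝ}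
    (hy : 0 < y) (ht : 0 < t) : U y ≤ t ↔ y ≤ f t := by
  rw [← h.strictMono.le_iff_le (inverse_pos hU hy) ht, apply_inverse hU hy]

theorem le_inverse_iff (h : RegularGrowth f f' l) (hU : IsInverseOnPos U f) {y t : ℝ}
    (hy : 0 < y) (ht : 0 < t) : t ≤ U y ↔ f t ≤ y := by
  rw [← h.strictMono.le_iff_le ht (inverse_pos hU hy), apply_inverse hU hy]

theorem inverse_mono (h : RegularGrowth f f' l) (hU : IsInverseOnPos U f) {x y : ℝ}
    (hx : 0 < x) (hxy : x ≤ y) : U x ≤ U y := by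
  rw [h.inverse_le_iff hU hx (inverse_pos hU (hx.trans_le hxy)),
    apply_inverse hU (hx.trans_le hxy)]
  exact hxy

theorem max_one_cast_pos (i : ℕ) : (0 : ℝ) < ((max i 1 : ℕ) : ℝ) :=
  Nat.cast_pos.2 (lt_of_lt_of_le one_pos (le_max_right i 1))

theorem inverse_quotient_pos (hU : IsInverseOnPos U f) (i : ℕ) :
    0 < U ((max i 1 : ℕ) : ℝ) :=
  inverse_pos hU (max_one_cast_pos i)

theorem inverseProd_pos (hU : IsInverseOnPos U f) (p : ℕ) : 0 < inverseProd U p :=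
  Finset.prod_pos fun i _ => inverse_quotient_pos hU i

theorem inverseProd_succ (U : ℝ → ℝ) (p : ℕ) :
    inverseProd U (p + 1) = inverseProd U p * U ((max p 1 : ℕ) : ℝ) :=
  Finset.prod_range_succ _ _

theorem isNormalizedPosSeq_inverseProd (hU : IsInverseOnPos U f) :
    IsNormalizedPosSeq (inverseProd U) :=
  ⟨Finset.prod_range_zero _, inverseProd_pos hU⟩

theorem seqQuotient_inverseProd (hU : IsInverseOnPos U f) (p : ℕ) :
    seqQuotient (inverseProd U) p = U ((max p 1 : ℕ) : ℝ) := by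
  rw [seqQuotient, inverseProd_succ, mul_div_cancel_left₀ _ (inverseProd_pos hU p).ne']

theorem isLogConvexSeq_inverseProd (h : RegularGrowth f f' l) (hU : IsInverseOnPos U f) :
    IsLogConvexSeq (inverseProd U) := fun p => by
  have hp := inverseProd_pos hU p
  have hq := inverse_quotient_pos hU p
  have hle : U ((max p 1 : ℕ) : ℝ) ≤ U ((max (p + 1) 1 : ℕ) : ℝ) :=
    h.inverse_mono hU (max_one_cast_pos p) (Nat.cast_le.2 (max_le_max_right _ p.le_succ))
  calc inverseProd U (p + 1) ^ 2
      = inverseProd U p * (inverseProd U p * U ((max p 1 : ℕ) : ℝ)) * U ((max p 1 : ℕ) : ℝ) := by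
        rw [inverseProd_succ]; ring
    _ ≤ inverseProd U p * (inverseProd U p * U ((max p 1 : ℕ) : ℝ))
          * U ((max (p + 1) 1 : ℕ) : ℝ) := by gcongr
    _ = _ := by rw [inverseProd_succ U (p + 1), inverseProd_succ]; ring

theorem tendsto_seqQuotient_inverseProd (h : RegularGrowth f f' l) (hU : IsInverseOnPos U f) :
    Tendsto (seqQuotient (inverseProd U)) atTop atTop := by
  refine Filter.tendsto_atTop.2 fun b => ?_
  filter_upwards [eventually_ge_atTop ⌈f (max b 1)⌉₊] with p hp
  rw [seqQuotient_inverseProd hU]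
  refine (le_max_left b 1).trans ((h.le_inverse_iff hU (max_one_cast_pos p)
    (lt_of_lt_of_le one_pos (le_max_right _ _))).2 ?_)
  exact (Nat.ceil_le.1 hp).trans (Nat.cast_le.2 (le_max_left _ _))

/-! ### Comparison with the Legendre-type sequence `sup t ^ p / exp (f t)` -/

theorem log_inverseProd (hU : IsInverseOnPos U f) (p : ℕ) :
    Real.log (inverseProd U p) =
      ∑ i ∈ Finset.range p, Real.log (U ((max i 1 : ℕ) : ℝ)) :=
  Real.log_prod fun i _ => (inverse_quotient_pos hU i).ne'

theorem inverseProd_le (h : RegularGrowth f f' l) (hU : IsInverseOnPos U f) (p : ℕ) :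
    inverseProd U p ≤ U p ^ p := by
  refine (Finset.prod_le_prod (fun i _ => (inverse_quotient_pos hU i).le)
    (fun i hi => ?_)).trans_eq (by rw [Finset.prod_const, Finset.card_range])
  have hi' := Finset.mem_range.1 hi
  exact h.inverse_mono hU (max_one_cast_pos i) (Nat.cast_le.2 (by omega))

/-- Since i + 1 ≤ 2 max(i, 1), the sum is at least log p! − p log 2, and p^p / p! ≤ e^p does the
rest. -/
theorem mul_log_sub_sum_log_le (p : ℕ) :
    p * Real.log p - ∑ i ∈ Finset.range p, Real.log ((max i 1 : ℕ) : ℝ)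
      ≤ p * (1 + Real.log 2) := by
  rcases Nat.eq_zero_or_pos p with rfl | hp
  · simp
  have hp' : (0 : ℝ) < p := Nat.cast_pos.2 hp
  have h1 : ∑ i ∈ Finset.range p, (Real.log ((i + 1 : ℕ) : ℝ) - Real.log 2)
      ≤ ∑ i ∈ Finset.range p, Real.log ((max i 1 : ℕ) : ℝ) := by
    refine Finset.sum_le_sum fun i _ => ?_
    rw [sub_le_iff_le_add, ← Real.log_mul (max_one_cast_pos i).ne' two_ne_zero]
    refine Real.log_le_log (Nat.cast_pos.2 i.succ_pos) ?_
    have : i + 1 ≤ max i 1 * 2 := by omega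
    exact_mod_cast this
  rw [Finset.sum_sub_distrib, Finset.sum_const, Finset.card_range, nsmul_eq_mul,
    ← Real.log_prod (fun i _ => (Nat.cast_pos.2 i.succ_pos).ne'), ← Nat.cast_prod,
    Finset.prod_range_add_one_eq_factorial] at h1
  have h2 := Real.log_le_log (by positivity) (Real.pow_div_factorial_le_exp (p : ℝ) hp'.le p)
  rw [Real.log_exp, Real.log_div (by positivity) (by positivity), Real.log_pow] at h2
  linarith

theorem exists_pow_inverse_le (h : RegularGrowth f f' l) (hU : IsInverseOnPos U f) :
    ∃ A, ∀ p : ℕ, 0 < p → p * Real.log (U p) ≤ Real.log (inverseProd U p) + p * A := by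
  have hU1 := inverse_pos hU one_pos
  obtain ⟨c, hc, hc'⟩ := h.exists_index_lower_bound hU1
  refine ⟨(1 + Real.log 2) / c, fun p hp => ?_⟩
  have hp' : (0 : ℝ) < p := Nat.cast_pos.2 hp
  have key : ∀ i ∈ Finset.range p,
      Real.log (U p) - Real.log (U ((max i 1 : ℕ) : ℝ)) ≤
        (Real.log p - Real.log ((max i 1 : ℕ) : ℝ)) / c := fun i hi => by
    have hi' := Finset.mem_range.1 hi
    rw [le_div_iff₀' hc]
    have := h.mul_log_sub_log_le hU1 hc'
      (h.inverse_mono hU one_pos (Nat.one_le_cast.2 (le_max_right i 1)))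
      (h.inverse_mono hU (max_one_cast_pos i) (y := p) (Nat.cast_le.2 (by omega)))
    rwa [apply_inverse hU hp', apply_inverse hU (max_one_cast_pos i)] at this
  have hs := Finset.sum_le_sum key
  rw [Finset.sum_sub_distrib, ← Finset.sum_div, Finset.sum_sub_distrib, ← log_inverseProd hU] at hs
  simp only [Finset.sum_const, Finset.card_range, nsmul_eq_mul] at hs
  have h3 := div_le_div_of_nonneg_right (mul_log_sub_sum_log_le p) hc.le
  rw [mul_div_assoc] at h3
  linarith

/-- Up to U(p) the term p log t is already bounded by p log U(p). Beyond it, f(t)/p ≥ (t/U(p))^c, so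
f(t) absorbs the growth of p log t. -/
theorem exists_mul_log_sub_le (h : RegularGrowth f f' l) (hU : IsInverseOnPos U f) :
    ∃ A, ∀ p : ℕ, 0 < p → ∀ t, 0 < t → p * Real.log t - f t ≤ p * Real.log (U p) + p * A := by
  have hU1 := inverse_pos hU one_pos
  obtain ⟨c, hc, hc'⟩ := h.exists_index_lower_bound hU1
  refine ⟨|Real.log c| / c, fun p hp t ht => ?_⟩
  have hp' : (0 : ℝ) < p := Nat.cast_pos.2 hp
  have hUp := inverse_pos hU hp'
  have hft := h.pos t ht
  rcases le_total t (U p) with htp | htp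
  · have h1 := mul_le_mul_of_nonneg_left (Real.log_le_log ht htp) hp'.le
    have h2 : 0 ≤ p * (|Real.log c| / c) := by positivity
    linarith
  · have h1 := h.mul_log_sub_log_le hU1 hc'
      (h.inverse_mono hU one_pos (Nat.one_le_cast.2 hp)) htp
    rw [apply_inverse hU hp', ← Real.log_div hft.ne' hp'.ne'] at h1
    -- The factor c is inserted so that, after division by c, f(t)/p appears with coefficient 1 and
    -- cancels against f(t).
    have h2 := Real.log_le_sub_one_of_pos (mul_pos hc (div_pos hft hp'))
    rw [Real.log_mul hc.ne' (div_pos hft hp').ne'] at h2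
    have h3 := neg_abs_le (Real.log c)
    have h4 : c * (Real.log t - Real.log (U p)) ≤ c * (f t / p) + |Real.log c| := by linarith
    have h5 : Real.log t - Real.log (U p) ≤ f t / p + |Real.log c| / c := by
      rw [← mul_le_mul_iff_right₀ hc, mul_add, mul_div_cancel₀ _ hc.ne']
      exact h4
    have h6 := mul_le_mul_of_nonneg_left h5 hp'.le
    rw [mul_add, mul_div_cancel₀ _ hp'.ne'] at h6
    linarith

/-- At p = 0 the constants C^p and D^p are 1, so equality is needed; the supremum is only
approached, as t → 0. -/
theorem iSup_exp_neg (h : RegularGrowth f f' l) :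
    ⨆ t : Ioi (0 : ℝ), (t : ℝ) ^ 0 / Real.exp (f t) = 1 := by
  have : Nonempty (Ioi (0 : ℝ)) := ⟨⟨1, mem_Ioi.2 one_pos⟩⟩
  have hle : ∀ t : Ioi (0 : ℝ), (t : ℝ) ^ 0 / Real.exp (f t) ≤ 1 := fun t => by
    rw [pow_zero]
    exact (div_le_one (Real.exp_pos _)).2 (Real.one_le_exp (h.pos t t.2).le)
  refine le_antisymm (ciSup_le hle) ?_
  have hlim : Tendsto (fun t => t ^ 0 / Real.exp (f t)) (𝓝[>] 0) (𝓝 1) := by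
    simpa using ((Real.continuous_exp.tendsto 0).comp h.tendsto_zero).inv₀ (by simp)
  refine le_of_tendsto hlim ?_
  filter_upwards [self_mem_nhdsWithin] with t ht
  exact le_ciSup (f := fun t : Ioi (0 : ℝ) => (t : ℝ) ^ 0 / Real.exp (f t))
    ⟨1, forall_mem_range.2 hle⟩ ⟨t, ht⟩

theorem seqEquivalent_inverseProd (h : RegularGrowth f f' l) (hU : IsInverseOnPos U f) :
    SeqEquivalent (inverseProd U) fun p => ⨆ t : Ioi (0 : ℝ), (t : ℝ) ^ p / Real.exp (f t) := by
  have : Nonempty (Ioi (0 : ℝ)) := ⟨⟨1, mem_Ioi.2 one_pos⟩⟩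
  obtain ⟨A, hA⟩ := h.exists_pow_inverse_le hU
  obtain ⟨B, hB⟩ := h.exists_mul_log_sub_le hU
  refine ⟨Real.exp 1, Real.exp (-(A + B)), Real.exp_pos _, Real.exp_pos _, fun p => ?_⟩
  rcases Nat.eq_zero_or_pos p with rfl | hp
  · simp only [h.iSup_exp_neg]
    simp [inverseProd]
  have hp' : (0 : ℝ) < p := Nat.cast_pos.2 hp
  have hLp := inverseProd_pos hU p
  have hle : ∀ t : Ioi (0 : ℝ), (t : ℝ) ^ p / Real.exp (f t) ≤
      Real.exp (p * (A + B)) * inverseProd U p := fun t => by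
    have ht : (0 : ℝ) < t := t.2
    rw [← Real.log_le_log_iff (by positivity) (by positivity),
      Real.log_div (by positivity) (by positivity), Real.log_pow, Real.log_exp,
      Real.log_mul (by positivity) hLp.ne', Real.log_exp]
    linarith [hA p hp, hB p hp t ht]
  constructor
  · rw [← Real.exp_nat_mul, mul_neg, Real.exp_neg, inv_mul_le_iff₀ (Real.exp_pos _)]
    exact ciSup_le hle
  -- Testing the supremum at t = U(p), where f = p, loses only the factor e^p.
  · have h1 := le_ciSup (f := fun t : Ioi (0 : ℝ) => (t : ℝ) ^ p / Real.exp (f t))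
      ⟨_, forall_mem_range.2 hle⟩ ⟨U p, inverse_pos hU hp'⟩
    simp only [apply_inverse hU hp'] at h1
    rw [div_le_iff₀ (Real.exp_pos _)] at h1
    rw [← Real.exp_nat_mul, mul_one, mul_comm]
    exact (h.inverseProd_le hU p).trans h1

end RegularGrowth

/-! ### The associated function, its lateral derivatives and asymptotics -/

namespace RegularGrowth

variable {f f' U : ℝ → ℝ} {l : ℝ}

/-- Consecutive terms differ by log t − log ℓ_q, so they increase while ℓ_q ≤ t and decrease
afterwards. The maximum is at k + 1, not k, because U(1) occurs twice among the quotients. Both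
bounds on f t are closed, so at an integer value two formulas hold, one for each side. -/
theorem associatedFunction_eq (h : RegularGrowth f f' l) (hU : IsInverseOnPos U f)
    {k : ℕ} (hk : 1 ≤ k) {t : ℝ} (ht : 0 < t) (h₁ : (k : ℝ) ≤ f t) (h₂ : f t ≤ (k + 1 : ℕ)) :
    associatedFunction (inverseProd U) t =
      (k + 1 : ℕ) * Real.log t - Real.log (inverseProd U (k + 1)) := by
  set c : ℕ → ℝ := fun q => Real.log (t ^ q / inverseProd U q) with hc
  have hcq : ∀ q : ℕ, c q = q * Real.log t - Real.log (inverseProd U q) := fun q => by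
    rw [hc]
    simp only
    rw [Real.log_div (pow_pos ht q).ne' (inverseProd_pos hU q).ne', Real.log_pow]
  have hstep : ∀ q : ℕ, c (q + 1) = c q + (Real.log t - Real.log (U ((max q 1 : ℕ) : ℝ))) :=
    fun q => by
      rw [hcq, hcq, inverseProd_succ, Real.log_mul (inverseProd_pos hU q).ne'
        (inverse_quotient_pos hU q).ne']
      push_cast
      ring
  have hup : ∀ q, q < k + 1 → c q ≤ c (q + 1) := fun q hq => by
    rw [hstep]
    have : U ((max q 1 : ℕ) : ℝ) ≤ t := by
      refine (h.inverse_le_iff hU (max_one_cast_pos q) ht).2 (le_trans ?_ h₁)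
      exact Nat.cast_le.2 (max_le (Nat.lt_succ_iff.1 hq) hk)
    linarith [Real.log_le_log (inverse_quotient_pos hU q) this]
  have hdown : ∀ q, k + 1 ≤ q → c (q + 1) ≤ c q := fun q hq => by
    rw [hstep]
    have : t ≤ U ((max q 1 : ℕ) : ℝ) := by
      refine (h.le_inverse_iff hU (max_one_cast_pos q) ht).2 (h₂.trans ?_)
      exact Nat.cast_le.2 (hq.trans (le_max_left _ _))
    linarith [Real.log_le_log ht this]
  have hmax : ∀ q, c q ≤ c (k + 1) := fun q => by
    rcases le_total q (k + 1) with hq | hq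
    · exact Nat.decreasingInduction' (P := fun q => c q ≤ c (k + 1))
        (fun q hq' _ ih => (hup q hq').trans ih) hq le_rfl
    · exact Nat.le_induction (P := fun q _ => c q ≤ c (k + 1)) le_rfl
        (fun q hq' ih => (hdown q hq').trans ih) q hq
  rw [← hcq]
  exact le_antisymm (ciSup_le hmax) (le_ciSup (f := c) ⟨_, forall_mem_range.2 hmax⟩ (k + 1))

theorem log_sub_log_le_associatedFunction (h : RegularGrowth f f' l) (hU : IsInverseOnPos U f)
    {t : ℝ} (ht : 0 < t) (hft : 1 ≤ f t) :
    Real.log t - Real.log (U 1) ≤ associatedFunction (inverseProd U) t := by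
  have hk : 1 ≤ ⌊f t⌋₊ := Nat.le_floor (by simpa using hft)
  have h₁ := Nat.floor_le (h.pos t ht).le
  rw [h.associatedFunction_eq hU hk ht h₁ (by push_cast; exact (Nat.lt_floor_add_one _).le),
    log_inverseProd hU, Finset.sum_range_succ']
  have h2 : ∑ i ∈ Finset.range ⌊f t⌋₊, Real.log (U ((max (i + 1) 1 : ℕ) : ℝ)) ≤
      ⌊f t⌋₊ * Real.log t := by
    refine (Finset.sum_le_sum (g := fun _ => Real.log t) fun i hi => ?_).trans_eq (by simp)
    refine Real.log_le_log (inverse_quotient_pos hU _) ((h.inverse_le_iff hU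
      (max_one_cast_pos _) ht).2 (le_trans (Nat.cast_le.2 ?_) h₁))
    have := Finset.mem_range.1 hi
    omega
  have h3 : U ((max 0 1 : ℕ) : ℝ) = U 1 := by simp
  rw [h3]
  push_cast at h2 ⊢
  linarith

theorem eventually_lt_apply (h : RegularGrowth f f' l) {t y : ℝ} (ht : 0 < t) (hy : y < f t) :
    ∀ᶠ x in 𝓝 t, y < f x :=
  (h.hasDerivAt t ht).continuousAt.eventually (lt_mem_nhds hy)

theorem eventually_apply_lt (h : RegularGrowth f f' l) {t y : ℝ} (ht : 0 < t) (hy : f t < y) :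
    ∀ᶠ x in 𝓝 t, f x < y :=
  (h.hasDerivAt t ht).continuousAt.eventually (gt_mem_nhds hy)

theorem hasDerivWithinAt_associatedFunction (h : RegularGrowth f f' l)
    (hU : IsInverseOnPos U f) {k : ℕ} (hk : 1 ≤ k) {t : ℝ} (ht : 0 < t) {s : Set ℝ} (hts : t ∈ s)
    (hs : ∀ᶠ x in 𝓝[s] t, (k : ℝ) ≤ f x ∧ f x ≤ (k + 1 : ℕ)) :
    HasDerivWithinAt (associatedFunction (inverseProd U)) ((k + 1 : ℕ) / t) s t := by
  have hd : HasDerivAt (fun x => (k + 1 : ℕ) * Real.log x - Real.log (inverseProd U (k + 1)))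
      ((k + 1 : ℕ) * t⁻¹) t := ((Real.hasDerivAt_log ht.ne').const_mul _).sub_const _
  rw [div_eq_mul_inv]
  refine hd.hasDerivWithinAt.congr_of_eventuallyEq_of_mem ?_ hts
  filter_upwards [hs, mem_nhdsWithin_of_mem_nhds (Ioi_mem_nhds ht)] with x hx hx0
  exact h.associatedFunction_eq hU hk hx0 hx.1 hx.2

theorem hasDerivWithinAt_right_associatedFunction (h : RegularGrowth f f' l)
    (hU : IsInverseOnPos U f) {t : ℝ} (ht : 0 < t) (hft : 1 < f t) :
    HasDerivWithinAt (associatedFunction (inverseProd U)) ((⌊f t⌋₊ + 1 : ℕ) / t) (Ici t) t := by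
  refine h.hasDerivWithinAt_associatedFunction hU (Nat.le_floor (by simpa using hft.le)) ht
    self_mem_Ici ?_
  filter_upwards [self_mem_nhdsWithin, mem_nhdsWithin_of_mem_nhds
    (h.eventually_apply_lt ht (Nat.lt_floor_add_one (f t)))] with x hx hx'
  refine ⟨(Nat.floor_le (h.pos t ht).le).trans
    (h.strictMono.monotoneOn ht (mem_Ioi.2 (ht.trans_le hx)) hx), ?_⟩
  push_cast
  exact hx'.le

/-- On the left the relevant range is k < f ≤ k + 1 with k + 1 = ⌈f t⌉; the slope jumps exactly when
f t is an integer. -/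
theorem hasDerivWithinAt_left_associatedFunction (h : RegularGrowth f f' l)
    (hU : IsInverseOnPos U f) {t : ℝ} (ht : 0 < t) (hft : 1 < f t) :
    HasDerivWithinAt (associatedFunction (inverseProd U)) ((⌈f t⌉₊ : ℕ) / t) (Iic t) t := by
  have hceil : 1 < ⌈f t⌉₊ := Nat.lt_ceil.2 (by simpa using hft)
  obtain ⟨k, hk⟩ : ∃ k, ⌈f t⌉₊ = k + 1 := ⟨⌈f t⌉₊ - 1, by omega⟩
  have hkt : (k : ℝ) < f t := Nat.lt_ceil.1 (by omega)
  rw [hk]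
  refine h.hasDerivWithinAt_associatedFunction hU (by omega) ht self_mem_Iic ?_
  filter_upwards [self_mem_nhdsWithin, mem_nhdsWithin_of_mem_nhds (Ioi_mem_nhds ht),
    mem_nhdsWithin_of_mem_nhds (h.eventually_lt_apply ht hkt)] with x hx hx0 hx'
  refine ⟨hx'.le, (h.strictMono.monotoneOn hx0 ht hx).trans ?_⟩
  rw [← hk]
  exact Nat.le_ceil _

theorem continuousAt_associatedFunction (h : RegularGrowth f f' l)
    (hU : IsInverseOnPos U f) {t : ℝ} (ht : 0 < t) (hft : 1 < f t) :
    ContinuousAt (associatedFunction (inverseProd U)) t :=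
  continuousAt_iff_continuous_left_right.2
    ⟨(h.hasDerivWithinAt_left_associatedFunction hU ht hft).continuousWithinAt,
      (h.hasDerivWithinAt_right_associatedFunction hU ht hft).continuousWithinAt⟩

theorem tendsto_floor_add_one_div (h : RegularGrowth f f' l) :
    Tendsto (fun t => ((⌊f t⌋₊ + 1 : ℕ) : ℝ) / f t) atTop (𝓝 1) := by
  have h1 := (tendsto_nat_floor_div_atTop (R := ℝ)).comp h.tendsto_atTop
  have h2 := h1.add (h.tendsto_atTop.const_div_atTop 1)
  rw [add_zero] at h2
  refine h2.congr fun t => ?_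
  simp only [Function.comp_apply]
  push_cast
  ring

theorem one_lt_apply (h : RegularGrowth f f' l) (hU : IsInverseOnPos U f) {t : ℝ}
    (ht : U 1 < t) : 1 < f t := by
  have hU1 := inverse_pos hU one_pos
  have := h.strictMono hU1 (hU1.trans ht) ht
  rwa [apply_inverse hU one_pos] at this

/-- The ratio of right derivatives is ((⌊f⌋ + 1)/f) / (t f'/f) → 1/l. -/
theorem tendsto_associatedFunction_div (h : RegularGrowth f f' l) (hU : IsInverseOnPos U f) :
    Tendsto (fun t => associatedFunction (inverseProd U) t / f t) atTop (𝓝 l⁻¹) := by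
  have hU1 := inverse_pos hU one_pos
  refine tendsto_div_of_right_deriv (t₀ := U 1)
    (a' := fun t => ((⌊f t⌋₊ + 1 : ℕ) : ℝ) / t) (b' := f')
    (fun t ht => (h.continuousAt_associatedFunction hU (hU1.trans ht)
      (h.one_lt_apply hU ht)).continuousWithinAt)
    (h.continuousOn.mono (Ioi_subset_Ioi hU1.le))
    (fun t ht => h.hasDerivWithinAt_right_associatedFunction hU (hU1.trans ht)
      (h.one_lt_apply hU ht))
    (fun t ht => (h.hasDerivAt t (hU1.trans ht)).hasDerivWithinAt)
    (fun t ht => h.deriv_pos t (hU1.trans ht)) ?_ h.tendsto_atTop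
  have := h.tendsto_floor_add_one_div.div h.tendsto_index h.index_pos.ne'
  rw [one_div] at this
  refine this.congr' ?_
  filter_upwards [eventually_gt_atTop 0] with t ht
  have h1 := (h.pos t ht).ne'
  have h2 := (h.deriv_pos t ht).ne'
  simp only [Pi.div_apply]
  field_simp

theorem tendsto_dFunction (h : RegularGrowth f f' l) (hU : IsInverseOnPos U f) :
    Tendsto (dFunction (inverseProd U)) atTop (𝓝 l) := by
  have hl := inv_pos.2 h.index_pos
  have h1 := ((h.tendsto_associatedFunction_div hU).log hl.ne').div_atTop Real.tendsto_log_atTop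
  have h2 := h1.add h.tendsto_log
  rw [zero_add] at h2
  refine h2.congr' ?_
  filter_upwards [eventually_gt_atTop 0,
    (h.tendsto_associatedFunction_div hU).eventually (lt_mem_nhds hl)] with t ht ht'
  have hft := h.pos t ht
  have ha : 0 < associatedFunction (inverseProd U) t := by
    have := mul_pos ht' hft
    rwa [div_mul_cancel₀ _ hft.ne'] at this
  rw [dFunction, Real.log_div ha.ne' hft.ne', ← add_div, sub_add_cancel]

/-! ### The function `dFunction` is a proximate order -/

/-- The derivative of `log a / log` at `t` when that of `a` is `n / t`. -/
noncomputable def logRatioDeriv (a : ℝ → ℝ) (n : ℕ) (t : ℝ) : ℝ :=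
  (n / t / a t * Real.log t - Real.log (a t) * t⁻¹) / Real.log t ^ 2

theorem hasDerivWithinAt_dFunction {M : ℕ → ℝ} {n : ℕ} {t : ℝ} {s : Set ℝ} (ht : 1 < t)
    (ha : 0 < associatedFunction M t)
    (hd : HasDerivWithinAt (associatedFunction M) (n / t) s t) :
    HasDerivWithinAt (dFunction M) (logRatioDeriv (associatedFunction M) n t) s t :=
  (hd.log ha.ne').div (Real.hasDerivAt_log (one_pos.trans ht).ne').hasDerivWithinAt
    (Real.log_pos ht).ne'

/-- The expression is affine in n with positive slope; hence d has a genuine corner wherever the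
slope of a jumps. -/
theorem logRatioDeriv_injective {a : ℝ → ℝ} {t : ℝ} (ht : 1 < t) (ha : 0 < a t) {m n : ℕ}
    (hmn : logRatioDeriv a m t = logRatioDeriv a n t) : m = n := by
  have h1 := Real.log_pos ht
  have ht0 := one_pos.trans ht
  rw [logRatioDeriv, logRatioDeriv, div_left_inj' (pow_pos h1 2).ne', sub_left_inj,
    mul_left_inj' h1.ne', div_left_inj' ha.ne', div_left_inj' ht0.ne'] at hmn
  exact_mod_cast hmn

theorem isProximateOrder_dFunction (h : RegularGrowth f f' l) (hU : IsInverseOnPos U f) :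
    IsProximateOrder (dFunction (inverseProd U)) l := by
  have hU1 := inverse_pos hU one_pos
  set a := associatedFunction (inverseProd U) with ha_def
  -- Beyond e U(1), log t − log U(1) ≥ 1, which forces a ≥ 1 and so d ≥ 0.
  set c := max 1 (Real.exp 1 * U 1)
  have hc1 : ∀ t, c < t → 1 < t := fun t ht => (le_max_left _ _).trans_lt ht
  have hcU : ∀ t, c < t → Real.exp 1 * U 1 < t := fun t ht => (le_max_right _ _).trans_lt ht
  have hft : ∀ t, c < t → 1 < f t := fun t ht => h.one_lt_apply hU <|
    lt_of_le_of_lt (le_mul_of_one_le_left hU1.le (Real.one_le_exp zero_le_one)) (hcU t ht)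
  have ha1 : ∀ t, c < t → 1 ≤ a t := fun t ht => by
    refine le_trans ?_ (h.log_sub_log_le_associatedFunction hU (one_pos.trans (hc1 t ht))
      (hft t ht).le)
    have := Real.log_le_log (by positivity) (hcU t ht).le
    rw [Real.log_mul (Real.exp_pos _).ne' hU1.ne', Real.log_exp] at this
    linarith
  have ha : ∀ t, c < t → 0 < a t := fun t ht => one_pos.trans_le (ha1 t ht)
  have hright : ∀ t, c < t →
      HasDerivWithinAt (dFunction (inverseProd U)) (logRatioDeriv a (⌊f t⌋₊ + 1) t) (Ici t) t :=
    fun t ht => hasDerivWithinAt_dFunction (hc1 t ht) (ha t ht)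
      (h.hasDerivWithinAt_right_associatedFunction hU (one_pos.trans (hc1 t ht)) (hft t ht))
  have hleft : ∀ t, c < t →
      HasDerivWithinAt (dFunction (inverseProd U)) (logRatioDeriv a ⌈f t⌉₊ t) (Iic t) t :=
    fun t ht => hasDerivWithinAt_dFunction (hc1 t ht) (ha t ht)
      (h.hasDerivWithinAt_left_associatedFunction hU (one_pos.trans (hc1 t ht)) (hft t ht))
  have hac : ∀ t, c < t → ContinuousAt a t := fun t ht =>
    h.continuousAt_associatedFunction hU (one_pos.trans (hc1 t ht)) (hft t ht)
  have hderiv : ∀ t, c < t → ⌈f t⌉₊ = ⌊f t⌋₊ + 1 →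
      HasDerivAt (dFunction (inverseProd U)) (logRatioDeriv a (⌊f t⌋₊ + 1) t) t := fun t ht he => by
    have h1 := hleft t ht
    rw [he] at h1
    have := h1.union (hright t ht)
    rwa [Iic_union_Ici, hasDerivWithinAt_univ] at this
  have hdiff : ∀ t, c < t → DifferentiableAt ℝ (dFunction (inverseProd U)) t →
      ⌈f t⌉₊ = ⌊f t⌋₊ + 1 := fun t ht hd => by
    refine logRatioDeriv_injective (hc1 t ht) (ha t ht) ?_
    rw [(uniqueDiffOn_Iic t t self_mem_Iic).eq_deriv _ (hleft t ht)
        hd.hasDerivAt.hasDerivWithinAt,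
      (uniqueDiffOn_Ici t t self_mem_Ici).eq_deriv _ (hright t ht)
        hd.hasDerivAt.hasDerivWithinAt]
  refine ⟨c, zero_le_one.trans (le_max_left _ _), ?_, fun b => ?_, ?_, fun t ht hd => ?_,
    fun t ht => ?_, h.tendsto_dFunction hU, ?_⟩
  · intro t ht
    exact (continuousAt_iff_continuous_left_right.2 ⟨(hleft t ht).continuousWithinAt,
      (hright t ht).continuousWithinAt⟩).continuousWithinAt
  -- The injective f sends the corners up to b to natural numbers at most f b.
  · refine Set.Finite.of_finite_image (f := f) ?_
      (h.strictMono.injOn.mono fun t ht => one_pos.trans (hc1 t ht.1))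
    refine ((finite_Iic ⌊f b⌋₊).image (Nat.cast : ℕ → ℝ)).subset ?_
    rintro _ ⟨t, ⟨ht, htb, hd⟩, rfl⟩
    have ht0 := one_pos.trans (hc1 t ht)
    have hne : ¬ ⌈f t⌉₊ = ⌊f t⌋₊ + 1 := fun he => hd (hderiv t ht he).differentiableAt
    have hle : ⌈f t⌉₊ ≤ ⌊f t⌋₊ := by
      have := Nat.ceil_le_floor_add_one (f t)
      omega
    refine ⟨⌊f t⌋₊, Nat.floor_le_floor
      (h.strictMono.monotoneOn ht0 (mem_Ioi.2 (ht0.trans_le htb)) htb), ?_⟩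
    exact le_antisymm (Nat.floor_le (h.pos t ht0).le)
      ((Nat.le_ceil _).trans (Nat.cast_le.2 hle))
  · rintro t ⟨ht, hd⟩
    have ht0 := one_pos.trans (hc1 t ht)
    have he := hdiff t ht hd
    have hfloor : (⌊f t⌋₊ : ℝ) < f t := Nat.lt_ceil.1 (by omega)
    have hev : ∀ᶠ x in 𝓝 t,
        deriv (dFunction (inverseProd U)) x = logRatioDeriv a (⌊f t⌋₊ + 1) x := by
      filter_upwards [Ioi_mem_nhds ht, h.eventually_lt_apply ht0 hfloor,
        h.eventually_apply_lt ht0 (Nat.lt_floor_add_one (f t))] with x hx h1 h2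
      have e1 : ⌊f x⌋₊ = ⌊f t⌋₊ :=
        (Nat.floor_eq_iff (h.pos x (one_pos.trans (hc1 x hx))).le).2 ⟨h1.le, h2⟩
      have e2 : ⌈f x⌉₊ = ⌊f t⌋₊ + 1 := by
        refine (Nat.ceil_eq_iff (Nat.succ_ne_zero _)).2 ⟨?_, ?_⟩
        · simpa using h1
        · push_cast; exact h2.le
      rw [(hderiv x hx (by rw [e1, e2])).deriv, e1]
    have hcont : ContinuousAt (logRatioDeriv a (⌊f t⌋₊ + 1)) t := by
      have hlog := Real.continuousAt_log ht0.ne'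
      exact ((((continuousAt_const.div continuousAt_id ht0.ne').div (hac t ht)
        (ha t ht).ne').mul hlog).sub (((hac t ht).log (ha t ht).ne').mul
          (continuousAt_inv₀ ht0.ne'))).div (hlog.pow 2) (pow_pos (Real.log_pos (hc1 t ht)) 2).ne'
    exact (hcont.congr (hev.mono fun x hx => hx.symm)).continuousWithinAt
  · refine ⟨_, _, fun he => hd ?_, (hleft t ht).mono Iio_subset_Iic_self,
      (hright t ht).mono Ioi_subset_Ici_self⟩
    exact (hderiv t ht (logRatioDeriv_injective (hc1 t ht) (ha t ht) he)).differentiableAt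
  · exact div_nonneg (Real.log_nonneg (ha1 t ht)) (Real.log_nonneg (hc1 t ht).le)
  · have h1 : Tendsto (fun t => ((⌊f t⌋₊ + 1 : ℕ) : ℝ) / a t) atTop (𝓝 l) := by
      have := h.tendsto_floor_add_one_div.div (h.tendsto_associatedFunction_div hU)
        (inv_pos.2 h.index_pos).ne'
      rw [one_div, inv_inv] at this
      refine this.congr' ?_
      filter_upwards [eventually_gt_atTop c] with t ht
      have := (h.pos t (one_pos.trans (hc1 t ht))).ne'
      simp only [Pi.div_apply]
      exact div_div_div_cancel_right₀ this _ _
    have h2 := h1.sub (h.tendsto_dFunction hU)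
    rw [sub_self] at h2
    refine (h2.mono_left (inf_le_left (b := 𝓟
      {r : ℝ | DifferentiableAt ℝ (dFunction (inverseProd U)) r}))).congr' ?_
    have hev : ∀ᶠ t in atTop ⊓ 𝓟 {r : ℝ | DifferentiableAt ℝ (dFunction (inverseProd U)) r},
        c < t := (eventually_gt_atTop c).filter_mono inf_le_left
    filter_upwards [hev, mem_inf_of_right (mem_principal_self _)] with t ht hd
    rw [(hderiv t ht (hdiff t ht hd)).deriv, logRatioDeriv, dFunction]
    have hlog := (Real.log_pos (hc1 t ht)).ne'
    have ht0 := (one_pos.trans (hc1 t ht)).ne'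
    have ha0 := (ha t ht).ne'
    rw [← ha_def]
    field_simp

end RegularGrowth

/-! ### From the class to regular growth -/

theorem HolomorphicOnLogSector.exists_deriv {γ : ℝ} (hγ : 0 < γ) {V : ℝ × ℝ → ℂ}
    (hV : HolomorphicOnLogSector γ V) :
    ∃ F' : ℝ → ℝ, Continuous F' ∧
      ∀ s, HasDerivAt (fun s => onRay V (Real.exp s)) (F' s) s := by
  set G : ℂ → ℂ := fun ζ => V (Real.exp ζ.re, ζ.im) with hG
  have hopen : IsOpen {ζ : ℂ | |ζ.im| < γ} :=
    isOpen_lt (Complex.continuous_im.abs) continuous_const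
  have hmem : ∀ s : ℝ, (s : ℂ) ∈ {ζ : ℂ | |ζ.im| < γ} := fun s => by simpa using hγ
  have hdiff : DifferentiableOn ℂ G {ζ : ℂ | |ζ.im| < γ} := hV
  refine ⟨fun s => (deriv G s).re, ?_, fun s => ?_⟩
  · refine Complex.continuous_re.comp (continuous_iff_continuousAt.2 fun s => ?_)
    exact ContinuousAt.comp (g := deriv G) (f := fun s : ℝ => (s : ℂ))
      ((hdiff.deriv hopen).differentiableAt (hopen.mem_nhds (hmem s))).continuousAt
      Complex.continuous_ofReal.continuousAt
  · have h1 := (hdiff.differentiableAt (hopen.mem_nhds (hmem s))).hasDerivAt.real_of_complex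
    simpa [hG, onRay] using h1

theorem tendsto_atTop_of_proximateEquivalent {σ ρ : ℝ → ℝ} {l : ℝ}
    (h : ProximateEquivalent σ ρ) (hρ : Tendsto ρ atTop (𝓝 l)) : Tendsto σ atTop (𝓝 l) := by
  have h1 := (h.div_atTop Real.tendsto_log_atTop).add hρ
  rw [zero_add] at h1
  refine h1.congr' ?_
  filter_upwards [eventually_gt_atTop 1] with t ht
  rw [mul_div_cancel_right₀ _ (Real.log_pos ht).ne', sub_add_cancel]

theorem MemMaergoizClass.exists_regularGrowth {ρ : ℝ → ℝ} {l γ : ℝ} {V : ℝ × ℝ → ℂ}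
    (hV : MemMaergoizClass γ ρ l V) (hl : 0 < l) (hρ : Tendsto ρ atTop (𝓝 l)) (hγ : 0 < γ) :
    ∃ f', RegularGrowth (onRay V) f' l := by
  obtain ⟨F', hF', hd⟩ := hV.holomorphic.exists_deriv hγ
  have hlog := tendsto_atTop_of_proximateEquivalent hV.equivalent hρ
  have hderiv : ∀ t, 0 < t → HasDerivAt (onRay V) (F' (Real.log t) / t) t := fun t ht => by
    have h1 := (hd (Real.log t)).comp t (Real.hasDerivAt_log ht.ne')
    refine h1.congr_of_eventuallyEq ?_
    filter_upwards [Ioi_mem_nhds ht] with x hx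
    rw [Function.comp_apply, Real.exp_log hx]
  have hF'pos : ∀ s, 0 < F' s := fun s => by
    have hlt : onRay V (Real.exp (s - 1)) < onRay V (Real.exp s) :=
      hV.strictMono (Real.exp_pos _) (Real.exp_pos _) (Real.exp_lt_exp.2 (sub_one_lt s))
    -- The derivative of a convex function dominates the chord slope on its left, which is positive
    -- by strict monotonicity.
    have h1 := hV.strictConvex_exp.convexOn.slope_le_of_hasDerivAt (mem_univ (s - 1))
      (mem_univ s) (sub_one_lt s) (hd s)
    refine lt_of_lt_of_le ?_ h1
    rw [slope_def_field]
    exact div_pos (sub_pos.2 hlt) (by linarith)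
  refine ⟨fun t => F' (Real.log t) / t, hl, hV.pos, hV.strictMono, hderiv, ?_,
    fun t ht => div_pos (hF'pos _) ht, hV.tendsto_zero, hlog, ?_⟩
  · exact (hF'.comp_continuousOn (Real.continuousOn_log.mono fun t ht => ne_of_gt ht)).div
      continuousOn_id fun t ht => ne_of_gt ht
  · obtain ⟨l', c, hc, -, -, -, -, -, -, hD⟩ := hV.proximate
    have hder : ∀ t, 1 < t → HasDerivAt (fun r => Real.log (onRay V r) / Real.log r)
        ((F' (Real.log t) / t / onRay V t * Real.log t - Real.log (onRay V t) * t⁻¹)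
          / Real.log t ^ 2) t := fun t ht =>
      ((hderiv t (one_pos.trans ht)).log (hV.pos t (one_pos.trans ht)).ne').div
        (Real.hasDerivAt_log (one_pos.trans ht).ne') (Real.log_pos ht).ne'
    -- Beyond 1 every point is a point of differentiability, so the restricted filter is `atTop`
    -- itself.
    rw [inf_of_le_left (le_principal_iff.2 <| (eventually_gt_atTop (1 : ℝ)).mono
      fun t ht => (hder t ht).differentiableAt)] at hD
    have h1 := hD.add hlog
    rw [zero_add] at h1
    refine h1.congr' ?_
    filter_upwards [eventually_gt_atTop 1] with t ht
    have ht0 := (one_pos.trans ht).ne'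
    have hlt := (Real.log_pos ht).ne'
    have hft := (hV.pos t (one_pos.trans ht)).ne'
    rw [(hder t ht).deriv]
    field_simp
    ring

theorem proposition4p11 (ρ : ℝ → ℝ) (l : ℝ) (hl : 0 < l) (hρ : IsProximateOrder ρ l)
    (γ : ℝ) (hγ : 0 < γ) (V : ℝ × ℝ → ℂ) (hV : MemMaergoizClass γ ρ l V) :
    ∃ U : ℝ → ℝ, IsInverseOnPos U (onRay V) ∧
      ∃ L : ℕ → ℝ, IsNormalizedPosSeq L ∧
        seqQuotient L 0 = U 1 ∧ (∀ p : ℕ, 1 ≤ p → seqQuotient L p = U p) ∧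
        IsLogConvexSeq L ∧
        Tendsto (seqQuotient L) atTop atTop ∧
        SeqEquivalent L (maergoizSequence V) ∧
        IsNonzeroProximateOrder (dFunction L) := by
  obtain ⟨c, -, -, -, -, -, -, hlim, -⟩ := hρ
  obtain ⟨f', h⟩ := hV.exists_regularGrowth hl hlim hγ
  obtain ⟨U, hU⟩ := h.exists_inverse
  refine ⟨U, hU, inverseProd U, RegularGrowth.isNormalizedPosSeq_inverseProd hU, ?_,
    fun p hp => ?_, h.isLogConvexSeq_inverseProd hU, h.tendsto_seqQuotient_inverseProd hU,
    h.seqEquivalent_inverseProd hU, l, hl, h.isProximateOrder_dFunction hU⟩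
  · rw [RegularGrowth.seqQuotient_inverseProd hU]
    simp
  · rw [RegularGrowth.seqQuotient_inverseProd hU, max_eq_left hp]
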